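/- A two-party XOR game is given by finite question sets $X$ (Alice) and $Y$ (Bob), a probability distribution $p(x,y)$ on $X\times Y$ and a function $f:X\times Y\to\{0,1\}$. On receiving $x$ and $y$ the players, who do not communicate, answer with bits $a$ and $b$, and they win iff $a\oplus b=f(x,y)$. The game matrix is $\Phi_{xy}=(-1)^{f(x,y)}p(x,y)$. For a box $P(a,b|x,y)$ let $\omega(P)=\sum_{x,y}p(x,y)\sum_{a\oplus b=f(x,y)}P(a,b|x,y)$. The classical value $\omega_c$ is the supremum of $\omega(P)$ over local (hidden-variable) boxes $P$. The quantum value $\omega_q$ is the supremum of $\omega(P)$ over boxes $P(a,b|x,y)=\langle\psi|M_x^a\otimes N_y^b|\psi\rangle$ with a unit vector $|\psi\rangle\in\mathcal H_A\otimes\mathcal H_B$ and projective measurements $\{M_x^a\}_a$ on $\mathcal H_A$ and $\{N_y^b\}_b$ on $\mathcal H_B$, for arbitrary complex Hilbert spaces $\mathcal H_A,\mathcal H_B$. There is no quantum advantage if $\omega_q=\omega_c$. **Theorem.** Consider a two-party XOR game whose game matrix $\Phi$ has no all-zero row and no all-zero column. Let $S_c=|s^A\rangle\langle s^B|$ be the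 strategy matrix of an optimal classical deterministic strategy: $s^A_x=(-1)^{\alpha(x)}$ and $s^B_y=(-1)^{\beta(y)}$, where the deterministic answers $a=\alpha(x)$, $b=\beta(y)$ attain $\omega_c$. Let $$\Sigma=\mathrm{Diag}\big(\{\langle i|\Phi|s^B\rangle\langle s^A|i\rangle\}_{i\in X}\big),\qquad \Lambda=\mathrm{Diag}\big(\{\langle i|s^B\rangle\langle s^A|\Phi|i\rangle\}_{i\in Y}\big).$$ There is no quantum advantage for $\Phi$ if and only if $\Sigma$ and $\Lambda$ are positive definite and $$\rho(\Lambda^{-1}\Phi^{T}\Sigma^{-1}\Phi)=1,$$ where $\rho$ denotes the spectral radius, the largest modulus of a (complex) eigenvalue. -/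

import Mathlib

open scoped TensorProduct Matrix

noncomputable section

/-- A box `P a b x y = P(a, b | x, y)` with question sets `X`, `Y` and one output bit per player. -/
abbrev Box (X Y : Type*) := Bool → Bool → X → Y → ℝ

/-- The sign `(-1) ^ b` of a bit. -/
def bitSign (b : Bool) : ℝ := if b then -1 else 1

/-- Local boxes: `P(a, b | x, y) = ∫ p(a | x, l) p(b | y, l) dq(l)` for a hidden variable `l`
distributed according to a probability measure `q` that does not depend on the questions. -/
def Box.IsLocal {X Y : Type*} (P : Box X Y) : Prop :=
  ∃ (L : Type) (_ : MeasurableSpace L) (q : MeasureTheory.Measure L)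
    (pA : L → Bool → X → ℝ) (pB : L → Bool → Y → ℝ),
    MeasureTheory.IsProbabilityMeasure q ∧
    (∀ a x, Measurable fun l => pA l a x) ∧ (∀ b y, Measurable fun l => pB l b y) ∧
    (∀ l a x, 0 ≤ pA l a x) ∧ (∀ l b y, 0 ≤ pB l b y) ∧
    (∀ l x, ∑ a, pA l a x = 1) ∧ (∀ l y, ∑ b, pB l b y = 1) ∧
    ∀ a b x y, P a b x y = ∫ l, pA l a x * pB l b y ∂q

/-- The deterministic local box in which Alice answers `α x` and Bob answers `β y`. -/
def Box.deterministic {X Y : Type*} (α : X → Bool) (β : Y → Bool) : Box X Y :=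
  fun a b x y => if α x = a ∧ β y = b then 1 else 0

/-- A projective measurement with outcomes in `ι` on a Hilbert space `H`. -/
structure ProjectiveMeasurement (ι : Type*) [Fintype ι] (H : Type*) [NormedAddCommGroup H]
    [InnerProductSpace ℂ H] [CompleteSpace H] where
  proj : ι → H →L[ℂ] H
  isStarProjection : ∀ i, IsStarProjection (proj i)
  orthogonal : ∀ i j, i ≠ j → proj i * proj j = 0
  sum_eq_one : ∑ i, proj i = 1

/-- The Hilbert space tensor product: the completion of the algebraic tensor product. -/
abbrev HilbertTensor (H K : Type*) [NormedAddCommGroup H] [InnerProductSpace ℂ H]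
    [NormedAddCommGroup K] [InnerProductSpace ℂ K] :=
  UniformSpace.Completion (H ⊗[ℂ] K)

/-- The operator `S ⊗ T` on the Hilbert space tensor product. -/
def HilbertTensor.map {H K : Type*} [NormedAddCommGroup H] [InnerProductSpace ℂ H]
    [NormedAddCommGroup K] [InnerProductSpace ℂ K] (S : H →L[ℂ] H) (T : K →L[ℂ] K) :
    HilbertTensor H K →L[ℂ] HilbertTensor H K :=
  (TensorProduct.mapL S T).completion

/-- Quantum boxes: `P(a, b | x, y) = ⟨ψ| M_x^a ⊗ N_y^b |ψ⟩` for a unit vector `ψ` in the tensor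
product of two arbitrary Hilbert spaces and projective measurements `M_x` and `N_y` on the two
tensor factors. -/
def Box.IsQuantum {X Y : Type*} (P : Box X Y) : Prop :=
  ∃ (HA HB : Type) (_ : NormedAddCommGroup HA) (_ : InnerProductSpace ℂ HA) (_ : CompleteSpace HA)
    (_ : NormedAddCommGroup HB) (_ : InnerProductSpace ℂ HB) (_ : CompleteSpace HB)
    (ψ : HilbertTensor HA HB) (M : X → ProjectiveMeasurement Bool HA)
    (N : Y → ProjectiveMeasurement Bool HB),
    ‖ψ‖ = 1 ∧
    ∀ a b x y,
      (P a b x y : ℂ) = inner ℂ ψ (HilbertTensor.map ((M x).proj a) ((N y).proj b) ψ)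

/-- A two-party XOR game: the referee draws the questions `(x, y)` with probability `p x y`, and
answers `a`, `b` win iff `a ⊕ b = f x y`. -/
structure XORGame (X Y : Type*) [Fintype X] [Fintype Y] where
  p : X → Y → ℝ
  p_nonneg : ∀ x y, 0 ≤ p x y
  p_sum : ∑ x, ∑ y, p x y = 1
  f : X → Y → Bool

namespace XORGame

variable {X Y : Type*} [Fintype X] [Fintype Y]

/-- The payoff function `V(a, b | x, y)`. -/
def payoff (g : XORGame X Y) (a b : Bool) (x : X) (y : Y) : ℝ :=
  if xor a b = g.f x y then 1 else 0

/-- The average probability of success `ω` of the strategy described by the box `P`. -/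
def winProb (g : XORGame X Y) (P : Box X Y) : ℝ :=
  ∑ x, ∑ y, ∑ a, ∑ b, g.p x y * g.payoff a b x y * P a b x y

/-- The classical value `ω_c`. -/
def classicalValue (g : XORGame X Y) : ℝ :=
  sSup {w | ∃ P : Box X Y, P.IsLocal ∧ g.winProb P = w}

/-- The quantum value `ω_q`. -/
def quantumValue (g : XORGame X Y) : ℝ :=
  sSup {w | ∃ P : Box X Y, P.IsQuantum ∧ g.winProb P = w}

/-- There is no quantum advantage: `ω_q = ω_c`. -/
def NoQuantumAdvantage (g : XORGame X Y) : Prop :=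
  g.quantumValue = g.classicalValue

/-- The deterministic strategy with answers `α`, `β` is an optimal classical strategy. Its strategy
matrix is `|s^A⟩⟨s^B|` with `s^A_x = (-1) ^ α x` and `s^B_y = (-1) ^ β y`. -/
def IsOptimalClassical (g : XORGame X Y) (α : X → Bool) (β : Y → Bool) : Prop :=
  g.winProb (Box.deterministic α β) = g.classicalValue

/-- The game matrix `Φ`. -/
def gameMatrix (g : XORGame X Y) : Matrix X Y ℝ :=
  Matrix.of fun x y => bitSign (g.f x y) * g.p x y

end XORGame

/-- `Σ = Diag(⟨i|Φ|s^B⟩⟨s^A|i⟩)`. -/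
def sigmaMatrix {X Y : Type*} [Fintype Y] [DecidableEq X]
    (Φ : Matrix X Y ℝ) (sA : X → ℝ) (sB : Y → ℝ) : Matrix X X ℝ :=
  Matrix.diagonal fun i => (Φ *ᵥ sB) i * sA i

/-- `Λ = Diag(⟨i|s^B⟩⟨s^A|Φ|i⟩)`. -/
def lambdaMatrix {X Y : Type*} [Fintype X] [DecidableEq Y]
    (Φ : Matrix X Y ℝ) (sA : X → ℝ) (sB : Y → ℝ) : Matrix Y Y ℝ :=
  Matrix.diagonal fun i => sB i * (sA ᵥ* Φ) i

/-- The spectral radius of a real matrix: the largest modulus of its complex eigenvalues. -/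
def realSpectralRadius {n : Type*} [Fintype n] [DecidableEq n] (M : Matrix n n ℝ) : ENNReal :=
  spectralRadius ℂ (M.map Complex.ofReal)

end

/-!
Write `M = [[Σ, -Φ], [-Φᵀ, Λ]]`. As a quadratic form, `M` is
`∑ Φ x y * sA x * sB y * (sA x * c x - sB y * d y) ^ 2`; this makes it a dual certificate for the
semidefinite program maximising `∑ Φ x y ⟪u x, v y⟫` over unit vectors. If `M` is positive
semidefinite, its Schur product with a Gram matrix shows that no unit vectors beat the signs
`sA`, `sB`, and the correlators of a quantum box are always such inner products. Conversely, all
inner products of unit vectors in the plane are correlators of a quantum box, by measuring a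
maximally entangled pair of qubits. Rotating the signs `sA`, `sB` by small angles inside the plane
changes the objective only to second order, by a negative multiple of the quadratic form `M`, so
`M` is positive semidefinite whenever the signs are optimal among quantum strategies.

When `Σ` and `Λ` are positive definite, `M` is positive semidefinite iff its Schur complement
`Λ - Φᵀ Σ⁻¹ Φ` is, iff `ρ(Λ⁻¹ Φᵀ Σ⁻¹ Φ) ≤ 1`. Because `Σ sA = Φ sB` and `Λ sB = Φᵀ sA`, the vector
`sB` is fixed by `Λ⁻¹ Φᵀ Σ⁻¹ Φ`, so this spectral radius is never less than `1`.
-/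

noncomputable section

section SpectralRadius

lemma spectralRadius_mul_comm (𝕜 : Type*) {A : Type*} [NormedField 𝕜] [Ring A] [Algebra 𝕜 A]
    (a b : A) : spectralRadius 𝕜 (a * b) = spectralRadius 𝕜 (b * a) := by
  suffices h : ∀ a b : A, spectralRadius 𝕜 (a * b) ≤ spectralRadius 𝕜 (b * a) from
    (h a b).antisymm (h b a)
  intro a b
  refine iSup₂_le fun k hk ↦ ?_
  obtain rfl | hk0 := eq_or_ne k 0
  · simp
  · have hk' : k ∈ spectrum 𝕜 (b * a) \ {0} := spectrum.nonzero_mul_comm (𝕜 := 𝕜) a b ▸ ⟨hk, hk0⟩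
    exact le_iSup₂_of_le k hk'.1 le_rfl

lemma le_iff_spectralRadius_inv_mul_le_one {A : Type*} [CStarAlgebra A] [PartialOrder A]
    [StarOrderedRing A] {a : A} {b : Aˣ} (ha : 0 ≤ a) (hb : 0 ≤ (b : A)) :
    a ≤ b ↔ spectralRadius ℂ (↑b⁻¹ * a) ≤ 1 := by
  set s := CFC.sqrt a
  set t := CFC.sqrt (↑b⁻¹ : A)
  have hst : star (s * t) * (s * t) = t * a * t := by
    rw [star_mul, (CFC.sqrt_nonneg a).isSelfAdjoint.star_eq,
      (CFC.sqrt_nonneg (↑b⁻¹ : A)).isSelfAdjoint.star_eq, mul_assoc, ← mul_assoc s,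
      CFC.sqrt_mul_sqrt_self a, mul_assoc]
  have hconj : spectralRadius ℂ (↑b⁻¹ * a) = (‖s * t‖₊ * ‖s * t‖₊ : NNReal) :=
    calc spectralRadius ℂ (↑b⁻¹ * a)
        = spectralRadius ℂ (t * (t * a)) := by
          rw [← mul_assoc, CFC.sqrt_mul_sqrt_self _ (CFC.inv_nonneg_of_nonneg b hb)]
      _ = spectralRadius ℂ (star (s * t) * (s * t)) := by rw [spectralRadius_mul_comm, hst]
      _ = ‖star (s * t) * (s * t)‖₊ := (IsSelfAdjoint.star_mul_self _).spectralRadius_eq_nnnorm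
      _ = _ := by rw [CStarRing.nnnorm_star_mul_self]
  rw [le_iff_norm_sqrt_mul_sqrt_inv ha hb, hconj, ENNReal.coe_le_one_iff, ← sq,
    pow_le_one_iff two_ne_zero, ← NNReal.coe_le_one, coe_nnnorm]

variable {n 𝕜 : Type*} [Fintype n]

lemma nnnorm_le_spectralRadius_of_mulVec_eq_smul [DecidableEq n] [NormedField 𝕜]
    {M : Matrix n n 𝕜} {μ : 𝕜} {v : n → 𝕜} (hv : v ≠ 0) (h : M *ᵥ v = μ • v) :
    (‖μ‖₊ : ENNReal) ≤ spectralRadius 𝕜 M := by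
  have hμ : Module.End.HasEigenvalue M.toLin' μ :=
    Module.End.hasEigenvalue_of_hasEigenvector ⟨Module.End.mem_eigenspace_iff.2 h, hv⟩
  exact le_iSup₂_of_le μ (M.spectrum_toLin' ▸ hμ.mem_spectrum) le_rfl

lemma one_le_realSpectralRadius_of_mulVec_eq_self [DecidableEq n] {M : Matrix n n ℝ} {v : n → ℝ}
    (hv : v ≠ 0) (h : M *ᵥ v = v) : 1 ≤ realSpectralRadius M := by
  have hvC : Complex.ofReal ∘ v ≠ 0 := fun h0 ↦ hv <| funext fun i ↦ by simpa using congrFun h0 i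
  have hMv : M.map Complex.ofReal *ᵥ (Complex.ofReal ∘ v) = (1 : ℂ) • (Complex.ofReal ∘ v) := by
    rw [one_smul]
    funext i
    exact (Complex.ofRealHom.map_mulVec M v i).symm.trans (congrArg Complex.ofReal (congrFun h i))
  simpa [realSpectralRadius] using nnnorm_le_spectralRadius_of_mulVec_eq_smul hvC hMv

end SpectralRadius

section PosSemidef

variable {n 𝕜 : Type*} [RCLike 𝕜]

open scoped ComplexOrder MatrixOrder Matrix.Norms.L2Operator

lemma posSemidef_map_algebraMap_iff [Finite n] {A : Matrix n n ℝ} :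
    (A.map (algebraMap ℝ 𝕜)).PosSemidef ↔ A.PosSemidef := by
  classical
  have := Fintype.ofFinite n
  constructor <;> intro hA
  · have hherm : A.IsHermitian := Matrix.IsHermitian.ext fun i j ↦ by
      simpa using hA.isHermitian.apply i j
    refine .of_dotProduct_mulVec_nonneg hherm fun x ↦ ?_
    have hx : star (algebraMap ℝ 𝕜 ∘ x) ⬝ᵥ A.map (algebraMap ℝ 𝕜) *ᵥ (algebraMap ℝ 𝕜 ∘ x) =
        ((star x ⬝ᵥ A *ᵥ x : ℝ) : 𝕜) := by
      simp [dotProduct, Matrix.mulVec]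
    exact_mod_cast hx ▸ hA.dotProduct_mulVec_nonneg (algebraMap ℝ 𝕜 ∘ x)
  · obtain ⟨B, rfl⟩ := CStarAlgebra.nonneg_iff_eq_star_mul_self.mp hA.nonneg
    have hstar : (star B).map (algebraMap ℝ 𝕜) = (B.map (algebraMap ℝ 𝕜))ᴴ := by
      ext i j
      simp
    rw [Matrix.map_mul, hstar]
    exact Matrix.posSemidef_conjTranspose_mul_self _

lemma diag_pos_of_posSemidef_of_apply_ne_zero {A : Matrix n n 𝕜} (hA : A.PosSemidef) {i j : n}
    (hij : A i j ≠ 0) : 0 < A i i := by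
  refine hA.diag_nonneg.lt_of_ne' fun hii ↦ hij ?_
  have hdet := (hA.submatrix ![i, j]).det_nonneg
  have hji : A j i = star (A i j) := (hA.isHermitian.apply j i).symm
  have hnorm : ‖A i j‖ ^ 2 ≤ 0 := by
    rw [Matrix.det_fin_two] at hdet
    simp only [Matrix.submatrix_apply, Matrix.cons_val_zero, Matrix.cons_val_one, hii, hji,
      zero_mul, zero_sub, RCLike.star_def, RCLike.mul_conj] at hdet
    exact_mod_cast neg_nonneg.1 hdet
  exact norm_eq_zero.1 (pow_eq_zero_iff two_ne_zero |>.1 (hnorm.antisymm (sq_nonneg _)))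

lemma posSemidef_sub_iff_realSpectralRadius_inv_mul_le_one [Fintype n] [DecidableEq n]
    {K L : Matrix n n ℝ} (hK : K.PosSemidef) (hL : L.PosDef) :
    (L - K).PosSemidef ↔ realSpectralRadius (L⁻¹ * K) ≤ 1 := by
  obtain ⟨U, rfl⟩ := hL.isUnit
  set toComplex := (algebraMap ℝ ℂ).mapMatrix (m := n)
  have hle := le_iff_spectralRadius_inv_mul_le_one (a := toComplex K)
    (b := Units.map toComplex.toMonoidHom U) (posSemidef_map_algebraMap_iff.2 hK).nonneg
    (posSemidef_map_algebraMap_iff.2 hL.posSemidef).nonneg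
  calc (U - K).PosSemidef ↔ (toComplex (U - K)).PosSemidef :=
        (posSemidef_map_algebraMap_iff (𝕜 := ℂ)).symm
    _ ↔ toComplex K ≤ toComplex U := by rw [Matrix.le_iff, map_sub]
    _ ↔ spectralRadius ℂ (toComplex (↑U⁻¹ * K)) ≤ 1 := by rw [map_mul]; exact hle
    _ ↔ _ := by rw [Matrix.coe_units_inv]; rfl

lemma sum_mul_inner_nonneg_of_posSemidef {E : Type*} [Fintype n] [NormedAddCommGroup E]
    [InnerProductSpace 𝕜 E] {A : Matrix n n 𝕜} (hA : A.PosSemidef) (z : n → E) :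
    0 ≤ ∑ i, ∑ j, A i j * inner 𝕜 (z i) (z j) := by
  simpa [dotProduct, Matrix.mulVec] using
    (hA.hadamard (Matrix.posSemidef_gram 𝕜 z)).dotProduct_mulVec_nonneg 1

end PosSemidef

section SecondOrder

lemma one_sub_cos_eq_sq_div_two_mul_sinc_sq (x : ℝ) :
    1 - Real.cos x = x ^ 2 / 2 * Real.sinc (x / 2) ^ 2 := by
  obtain rfl | hx := eq_or_ne x 0
  · simp
  · have hcos : Real.cos x = 1 - 2 * Real.sin (x / 2) ^ 2 := by
      have hdouble := Real.cos_two_mul (x / 2)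
      rw [mul_div_cancel₀ x two_ne_zero] at hdouble
      linarith [Real.sin_sq_add_cos_sq (x / 2)]
    rw [Real.sinc_of_ne_zero (div_ne_zero hx two_ne_zero), hcos]
    field

lemma sum_mul_sq_nonneg_of_forall_sum_mul_one_sub_cos_nonneg {ι : Type*} [Fintype ι]
    {w k : ι → ℝ} (h : ∀ r : ℝ, 0 ≤ ∑ i, w i * (1 - Real.cos (r * k i))) :
    0 ≤ ∑ i, w i * k i ^ 2 := by
  let f (r : ℝ) : ℝ := ∑ i, w i * (k i * Real.sinc (r * k i / 2)) ^ 2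
  have hf : Continuous f := by
    have := Real.continuous_sinc
    fun_prop
  have hfr {r : ℝ} (hr : r ≠ 0) : 0 ≤ f r := by
    have hcos : ∑ i, w i * (1 - Real.cos (r * k i)) = r ^ 2 / 2 * f r := by
      rw [Finset.mul_sum]
      refine Finset.sum_congr rfl fun i _ ↦ ?_
      rw [one_sub_cos_eq_sq_div_two_mul_sinc_sq]
      ring
    exact nonneg_of_mul_nonneg_right (hcos ▸ h r) (by positivity)
  have h0 : 0 ≤ f 0 := ge_of_tendsto (hf.continuousWithinAt (s := {0}ᶜ))
    (eventually_nhdsWithin_of_forall fun r hr ↦ hfr hr)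
  simpa [f] using h0

end SecondOrder

section Certificate

variable {X Y : Type*} [Fintype X] [Fintype Y]
  {Φ : Matrix X Y ℝ} {sA : X → ℝ} {sB : Y → ℝ}

lemma sigmaMatrix_mulVec [DecidableEq X] (hsA : ∀ x, sA x ^ 2 = 1) :
    sigmaMatrix Φ sA sB *ᵥ sA = Φ *ᵥ sB := by
  funext x
  rw [sigmaMatrix, Matrix.mulVec_diagonal, mul_assoc, ← sq, hsA, mul_one]

lemma lambdaMatrix_mulVec [DecidableEq Y] (hsB : ∀ y, sB y ^ 2 = 1) :
    lambdaMatrix Φ sA sB *ᵥ sB = Φᵀ *ᵥ sA := by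
  funext y
  rw [lambdaMatrix, Matrix.mulVec_diagonal, mul_right_comm, ← sq, hsB, one_mul,
    Matrix.mulVec_transpose]

variable [DecidableEq X] [DecidableEq Y]

/-- The dual certificate of the semidefinite program `max ∑ Φ x y ⟪u x, v y⟫` over unit vectors, at
the signs `sA`, `sB`. It is the Laplacian of the bipartite graph with edge weights
`Φ x y * sA x * sB y`, conjugated by the signs. -/
def certificateMatrix (Φ : Matrix X Y ℝ) (sA : X → ℝ) (sB : Y → ℝ) :
    Matrix (X ⊕ Y) (X ⊕ Y) ℝ :=
  Matrix.fromBlocks (sigmaMatrix Φ sA sB) (-Φ) (-Φᵀ) (lambdaMatrix Φ sA sB)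

lemma sum_certificateMatrix_mul_inner {E : Type*} [NormedAddCommGroup E] [InnerProductSpace ℝ E]
    (hsA : ∀ x, sA x ^ 2 = 1) (hsB : ∀ y, sB y ^ 2 = 1) (u : X → E) (v : Y → E) :
    ∑ i, ∑ j, certificateMatrix Φ sA sB i j * inner ℝ (Sum.elim u v i) (Sum.elim u v j) =
      ∑ x, ∑ y, Φ x y * sA x * sB y * ‖sA x • u x - sB y • v y‖ ^ 2 := by
  have hsq (x : X) (y : Y) : Φ x y * sA x * sB y * ‖sA x • u x - sB y • v y‖ ^ 2 =
      Φ x y * sB y * sA x * ‖u x‖ ^ 2 - Φ x y * inner ℝ (u x) (v y) -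
        Φ x y * inner ℝ (v y) (u x) + sB y * (sA x * Φ x y) * ‖v y‖ ^ 2 := by
    rw [norm_sub_sq_real, norm_smul, norm_smul, mul_pow, mul_pow, Real.norm_eq_abs,
      Real.norm_eq_abs, sq_abs, sq_abs, real_inner_smul_left, real_inner_smul_right,
      real_inner_comm (u x) (v y)]
    linear_combination (Φ x y * sA x * sB y * ‖u x‖ ^ 2 -
      2 * Φ x y * sB y ^ 2 * inner ℝ (u x) (v y)) * hsA x +
      (Φ x y * sA x * sB y * ‖v y‖ ^ 2 - 2 * Φ x y * inner ℝ (u x) (v y)) * hsB y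
  simp only [hsq, Finset.sum_add_distrib, Finset.sum_sub_distrib]
  rw [Finset.sum_comm (f := fun x y ↦ Φ x y * inner ℝ (v y) (u x)),
    Finset.sum_comm (f := fun x y ↦ sB y * (sA x * Φ x y) * ‖v y‖ ^ 2)]
  simp only [certificateMatrix, sigmaMatrix, lambdaMatrix, Fintype.sum_sum_type,
    Matrix.fromBlocks_apply₁₁, Matrix.fromBlocks_apply₁₂, Matrix.fromBlocks_apply₂₁,
    Matrix.fromBlocks_apply₂₂, Sum.elim_inl, Sum.elim_inr, Matrix.diagonal_apply, ite_mul,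
    zero_mul, Finset.sum_ite_eq, Finset.mem_univ, if_true, real_inner_self_eq_norm_sq,
    Matrix.neg_apply, Matrix.transpose_apply, neg_mul, Finset.sum_neg_distrib,
    Finset.sum_add_distrib, Matrix.mulVec, Matrix.vecMul, dotProduct, Finset.sum_mul,
    Finset.mul_sum]
  ring

lemma isHermitian_certificateMatrix : (certificateMatrix Φ sA sB).IsHermitian :=
  Matrix.IsHermitian.fromBlocks (Matrix.isHermitian_diagonal _) (by simp)
    (Matrix.isHermitian_diagonal _)

lemma posSemidef_certificateMatrix_iff (hsA : ∀ x, sA x ^ 2 = 1) (hsB : ∀ y, sB y ^ 2 = 1) :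
    (certificateMatrix Φ sA sB).PosSemidef ↔ ∀ (c : X → ℝ) (d : Y → ℝ),
      0 ≤ ∑ x, ∑ y, Φ x y * sA x * sB y * (sA x * c x - sB y * d y) ^ 2 := by
  have hform (c : X → ℝ) (d : Y → ℝ) :
      star (Sum.elim c d) ⬝ᵥ certificateMatrix Φ sA sB *ᵥ Sum.elim c d =
        ∑ x, ∑ y, Φ x y * sA x * sB y * (sA x * c x - sB y * d y) ^ 2 := by
    have hsum := sum_certificateMatrix_mul_inner (Φ := Φ) hsA hsB c d
    simp only [smul_eq_mul, Real.norm_eq_abs, sq_abs] at hsum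
    rw [← hsum]
    simp only [dotProduct, Matrix.mulVec, Finset.mul_sum, Pi.star_apply, star_trivial]
    refine Finset.sum_congr rfl fun i _ ↦ Finset.sum_congr rfl fun j _ ↦ ?_
    rw [Real.inner_apply]
    ring
  constructor
  · exact fun h c d ↦ hform c d ▸ h.dotProduct_mulVec_nonneg _
  · refine fun h ↦ .of_dotProduct_mulVec_nonneg isHermitian_certificateMatrix fun z ↦ ?_
    rw [← Sum.elim_comp_inl_inr z, hform]
    exact h _ _

lemma posDef_sigmaMatrix_of_posSemidef_certificateMatrix (hrow : ∀ x, ∃ y, Φ x y ≠ 0)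
    (h : (certificateMatrix Φ sA sB).PosSemidef) : (sigmaMatrix Φ sA sB).PosDef :=
  Matrix.PosDef.diagonal fun x ↦ by
    obtain ⟨y, hxy⟩ := hrow x
    simpa [certificateMatrix, sigmaMatrix] using
      diag_pos_of_posSemidef_of_apply_ne_zero h (i := .inl x) (j := .inr y) (neg_ne_zero.2 hxy)

lemma posDef_lambdaMatrix_of_posSemidef_certificateMatrix (hcol : ∀ y, ∃ x, Φ x y ≠ 0)
    (h : (certificateMatrix Φ sA sB).PosSemidef) : (lambdaMatrix Φ sA sB).PosDef :=
  Matrix.PosDef.diagonal fun y ↦ by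
    obtain ⟨x, hxy⟩ := hcol y
    simpa [certificateMatrix, lambdaMatrix] using
      diag_pos_of_posSemidef_of_apply_ne_zero h (i := .inr y) (j := .inl x) (neg_ne_zero.2 hxy)

lemma posSemidef_certificateMatrix_iff_realSpectralRadius_le_one
    (hS : (sigmaMatrix Φ sA sB).PosDef) (hL : (lambdaMatrix Φ sA sB).PosDef) :
    (certificateMatrix Φ sA sB).PosSemidef ↔
      realSpectralRadius ((lambdaMatrix Φ sA sB)⁻¹ * Φᵀ * (sigmaMatrix Φ sA sB)⁻¹ * Φ) ≤ 1 := by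
  have := hS.isUnit.invertible
  have hK : (Φᵀ * (sigmaMatrix Φ sA sB)⁻¹ * Φ).PosSemidef :=
    hS.inv.posSemidef.conjTranspose_mul_mul_same Φ
  rw [Matrix.mul_assoc, Matrix.mul_assoc, ← Matrix.mul_assoc Φᵀ,
    ← posSemidef_sub_iff_realSpectralRadius_inv_mul_le_one hK hL, certificateMatrix,
    show -Φᵀ = (-Φ)ᴴ by simp, Matrix.PosDef.fromBlocks₁₁ _ _ hS]
  simp

lemma inv_lambdaMatrix_mul_transpose_mul_inv_sigmaMatrix_mul_mulVec
    (hsA : ∀ x, sA x ^ 2 = 1) (hsB : ∀ y, sB y ^ 2 = 1)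
    (hS : (sigmaMatrix Φ sA sB).PosDef) (hL : (lambdaMatrix Φ sA sB).PosDef) :
    ((lambdaMatrix Φ sA sB)⁻¹ * Φᵀ * (sigmaMatrix Φ sA sB)⁻¹ * Φ) *ᵥ sB = sB := by
  have := hS.isUnit.invertible
  have := hL.isUnit.invertible
  rw [← Matrix.mulVec_mulVec, ← sigmaMatrix_mulVec hsA, Matrix.mulVec_mulVec,
    Matrix.inv_mul_cancel_right_of_invertible, ← Matrix.mulVec_mulVec, ← lambdaMatrix_mulVec hsB,
    Matrix.mulVec_mulVec, Matrix.inv_mul_of_invertible, Matrix.one_mulVec]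

theorem posSemidef_certificateMatrix_iff_realSpectralRadius_eq_one [Nonempty Y]
    (hrow : ∀ x, ∃ y, Φ x y ≠ 0) (hcol : ∀ y, ∃ x, Φ x y ≠ 0)
    (hsA : ∀ x, sA x ^ 2 = 1) (hsB : ∀ y, sB y ^ 2 = 1) :
    (certificateMatrix Φ sA sB).PosSemidef ↔
      (sigmaMatrix Φ sA sB).PosDef ∧ (lambdaMatrix Φ sA sB).PosDef ∧
        realSpectralRadius ((lambdaMatrix Φ sA sB)⁻¹ * Φᵀ * (sigmaMatrix Φ sA sB)⁻¹ * Φ) = 1 := by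
  constructor
  · intro h
    have hS := posDef_sigmaMatrix_of_posSemidef_certificateMatrix hrow h
    have hL := posDef_lambdaMatrix_of_posSemidef_certificateMatrix hcol h
    have hsB0 : sB ≠ 0 := fun h0 ↦ by
      obtain ⟨y⟩ := ‹Nonempty Y›
      simpa [h0] using hsB y
    have hfixed := inv_lambdaMatrix_mul_transpose_mul_inv_sigmaMatrix_mul_mulVec hsA hsB hS hL
    exact ⟨hS, hL, le_antisymm
      ((posSemidef_certificateMatrix_iff_realSpectralRadius_le_one hS hL).1 h)
      (one_le_realSpectralRadius_of_mulVec_eq_self hsB0 hfixed)⟩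
  · rintro ⟨hS, hL, hρ⟩
    exact (posSemidef_certificateMatrix_iff_realSpectralRadius_le_one hS hL).2 hρ.le

lemma sum_mul_inner_le_of_posSemidef_certificateMatrix {E : Type*} [NormedAddCommGroup E]
    [InnerProductSpace ℝ E] (hsA : ∀ x, sA x ^ 2 = 1) (hsB : ∀ y, sB y ^ 2 = 1)
    (h : (certificateMatrix Φ sA sB).PosSemidef) {u : X → E} {v : Y → E}
    (hu : ∀ x, ‖u x‖ = 1) (hv : ∀ y, ‖v y‖ = 1) :
    ∑ x, ∑ y, Φ x y * inner ℝ (u x) (v y) ≤ ∑ x, ∑ y, Φ x y * (sA x * sB y) := by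
  have hsq (x : X) (y : Y) : Φ x y * sA x * sB y * ‖sA x • u x - sB y • v y‖ ^ 2 =
      2 * (Φ x y * (sA x * sB y) - Φ x y * inner ℝ (u x) (v y)) := by
    rw [norm_sub_sq_real, norm_smul, norm_smul, mul_pow, mul_pow, Real.norm_eq_abs,
      Real.norm_eq_abs, sq_abs, sq_abs, real_inner_smul_left, real_inner_smul_right, hu, hv,
      hsA, hsB]
    linear_combination (-2 * Φ x y * sB y ^ 2 * inner ℝ (u x) (v y)) * hsA x -
      (2 * Φ x y * inner ℝ (u x) (v y)) * hsB y
  have hsum := sum_mul_inner_nonneg_of_posSemidef h (Sum.elim u v)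
  rw [sum_certificateMatrix_mul_inner hsA hsB] at hsum
  simp only [hsq, ← Finset.mul_sum, Finset.sum_sub_distrib] at hsum
  linarith

lemma inner_mul_exp_mul_I (a b s t : ℝ) :
    inner ℝ ((a : ℂ) * Complex.exp (s * Complex.I)) ((b : ℂ) * Complex.exp (t * Complex.I)) =
      a * b * Real.cos (s - t) := by
  simp only [Complex.inner, map_mul, Complex.conj_ofReal, Complex.mul_re, Complex.mul_im,
    Complex.ofReal_re, Complex.ofReal_im, Complex.conj_re, Complex.conj_im,
    Complex.exp_ofReal_mul_I_re, Complex.exp_ofReal_mul_I_im, Real.cos_sub]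
  ring

lemma posSemidef_certificateMatrix_of_forall_sum_mul_inner_le
    (hsA : ∀ x, sA x ^ 2 = 1) (hsB : ∀ y, sB y ^ 2 = 1)
    (h : ∀ (u : X → ℂ) (v : Y → ℂ), (∀ x, ‖u x‖ = 1) → (∀ y, ‖v y‖ = 1) →
      ∑ x, ∑ y, Φ x y * inner ℝ (u x) (v y) ≤ ∑ x, ∑ y, Φ x y * (sA x * sB y)) :
    (certificateMatrix Φ sA sB).PosSemidef := by
  have hnorm {s : ℝ} (hs : s ^ 2 = 1) (t : ℝ) : ‖(s : ℂ) * Complex.exp (t * Complex.I)‖ = 1 := by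
    rw [norm_mul, Complex.norm_exp_ofReal_mul_I, Complex.norm_real, mul_one, Real.norm_eq_abs]
    exact (pow_eq_one_iff_of_nonneg (abs_nonneg s) two_ne_zero).1 (by rw [sq_abs, hs])
  refine (posSemidef_certificateMatrix_iff hsA hsB).2 fun c d ↦ ?_
  rw [← Fintype.sum_prod_type']
  refine sum_mul_sq_nonneg_of_forall_sum_mul_one_sub_cos_nonneg fun r ↦ ?_
  have hr := h (fun x ↦ sA x * Complex.exp ((r * (sA x * c x) : ℝ) * Complex.I))
    (fun y ↦ sB y * Complex.exp ((r * (sB y * d y) : ℝ) * Complex.I))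
    (fun x ↦ hnorm (hsA x) _) (fun y ↦ hnorm (hsB y) _)
  simp only [inner_mul_exp_mul_I, ← mul_sub] at hr
  rw [Fintype.sum_prod_type]
  simp only [mul_assoc, mul_sub, mul_one, Finset.sum_sub_distrib] at hr ⊢
  exact sub_nonneg.2 hr

end Certificate

namespace HilbertTensor

variable {H K : Type*} [NormedAddCommGroup H] [InnerProductSpace ℂ H]
  [NormedAddCommGroup K] [InnerProductSpace ℂ K]

lemma map_coe (S : H →L[ℂ] H) (T : K →L[ℂ] K) (z : H ⊗[ℂ] K) :
    map S T (z : HilbertTensor H K) = (TensorProduct.mapL S T z : H ⊗[ℂ] K) :=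
  ContinuousLinearMap.completion_apply_coe _ _

lemma clm_ext {F G : HilbertTensor H K →L[ℂ] HilbertTensor H K}
    (h : ∀ z : H ⊗[ℂ] K, F z = G z) : F = G :=
  DFunLike.coe_injective <| UniformSpace.Completion.ext F.continuous G.continuous h

lemma map_mul (S S' : H →L[ℂ] H) (T T' : K →L[ℂ] K) :
    map (S * S') (T * T') = map S T * map S' T' :=
  clm_ext fun z ↦ by
    rw [mul_apply_eq_comp, map_coe, map_coe, map_coe, TensorProduct.mapL_mul,
      mul_apply_eq_comp]

lemma map_one : map (1 : H →L[ℂ] H) (1 : K →L[ℂ] K) = 1 :=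
  clm_ext fun z ↦ by
    rw [map_coe, ContinuousLinearMap.one_def, ContinuousLinearMap.one_def,
      TensorProduct.mapL_id_id, one_apply_eq_self, ContinuousLinearMap.id_apply]

/-- The bilinear map `(S, T) ↦ S ⊗ T`. -/
def mapBilinear : (H →L[ℂ] H) →ₗ[ℂ] (K →L[ℂ] K) →ₗ[ℂ] HilbertTensor H K →L[ℂ] HilbertTensor H K :=
  LinearMap.mk₂ ℂ map
    (fun S S' T ↦ clm_ext fun z ↦ by
      simp [map_coe, TensorProduct.mapL_add_left, UniformSpace.Completion.coe_add])
    (fun c S T ↦ clm_ext fun z ↦ by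
      simp [map_coe, TensorProduct.mapL_smul_left, UniformSpace.Completion.coe_smul])
    (fun S T T' ↦ clm_ext fun z ↦ by
      simp [map_coe, TensorProduct.mapL_add_right, UniformSpace.Completion.coe_add])
    (fun c S T ↦ clm_ext fun z ↦ by
      simp [map_coe, TensorProduct.mapL_smul_right, UniformSpace.Completion.coe_smul])

lemma map_sum_smul {ι κ : Type*} [Fintype ι] [Fintype κ] (s : ι → ℂ) (t : κ → ℂ)
    (S : ι → H →L[ℂ] H) (T : κ → K →L[ℂ] K) :
    map (∑ i, s i • S i) (∑ j, t j • T j) = ∑ i, ∑ j, (s i * t j) • map (S i) (T j) := by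
  change mapBilinear _ _ = ∑ i, ∑ j, _ • mapBilinear (S i) (T j)
  simp only [map_sum, LinearMap.sum_apply, map_smul, LinearMap.smul_apply, smul_smul,
    Finset.smul_sum]
  rw [Finset.sum_comm]
  simp [mul_comm]

lemma sum_mul_inner_map {ι κ : Type*} [Fintype ι] [Fintype κ] (s : ι → ℂ) (t : κ → ℂ)
    (S : ι → H →L[ℂ] H) (T : κ → K →L[ℂ] K) (ψ φ : HilbertTensor H K) :
    ∑ i, ∑ j, s i * t j * inner ℂ ψ (map (S i) (T j) φ) =
      inner ℂ ψ (map (∑ i, s i • S i) (∑ j, t j • T j) φ) := by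
  simp [map_sum_smul, inner_sum, inner_smul_right]

variable [CompleteSpace H] [CompleteSpace K]

lemma star_map (S : H →L[ℂ] H) (T : K →L[ℂ] K) : star (map S T) = map (star S) (star T) := by
  refine ((ContinuousLinearMap.eq_adjoint_iff _ _).2 fun z w ↦ ?_).symm
  induction z, w using UniformSpace.Completion.induction_on₂ with
  | hp => exact isClosed_eq (by fun_prop) (by fun_prop)
  | ih z w =>
    rw [map_coe, map_coe, UniformSpace.Completion.inner_coe, UniformSpace.Completion.inner_coe]
    induction z using TensorProduct.induction_on with
    | zero => simp
    | add z z' hz hz' => rw [map_add, inner_add_left, hz, hz', inner_add_left]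
    | tmul x y =>
      induction w using TensorProduct.induction_on with
      | zero => simp
      | add w w' hw hw' => rw [map_add, inner_add_right, hw, hw', inner_add_right]
      | tmul x' y' =>
        simp only [TensorProduct.mapL_tmul, TensorProduct.inner_tmul,
          ContinuousLinearMap.star_eq_adjoint, ContinuousLinearMap.adjoint_inner_left]

lemma map_mem_unitary {S : H →L[ℂ] H} {T : K →L[ℂ] K} (hS : S ∈ unitary (H →L[ℂ] H))
    (hT : T ∈ unitary (K →L[ℂ] K)) : map S T ∈ unitary (HilbertTensor H K →L[ℂ] _) := by
  rw [Unitary.mem_iff, star_map, ← map_mul, ← map_mul, Unitary.star_mul_self_of_mem hS,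
    Unitary.star_mul_self_of_mem hT, Unitary.mul_star_self_of_mem hS,
    Unitary.mul_star_self_of_mem hT, map_one]
  exact ⟨rfl, rfl⟩

lemma inner_map_left_map_right (S : H →L[ℂ] H) (T : K →L[ℂ] K) (ψ : HilbertTensor H K) :
    inner ℂ (map S 1 ψ) (map 1 T ψ) = inner ℂ ψ (map (star S) T ψ) := by
  rw [← ContinuousLinearMap.adjoint_inner_right, ← ContinuousLinearMap.star_eq_adjoint, star_map,
    ← mul_apply_eq_comp, ← map_mul, star_one, mul_one, one_mul]

end HilbertTensor

section MaximallyEntangled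

variable {n : Type*} [Fintype n] [DecidableEq n]

/-- The maximally entangled state `(card n)^(-1/2) ∑ i, |i⟩ ⊗ |i⟩`. -/
def maximallyEntangled (n : Type*) [Fintype n] [DecidableEq n] :
    HilbertTensor (EuclideanSpace ℂ n) (EuclideanSpace ℂ n) :=
  (((√(Fintype.card n) : ℝ)⁻¹ : ℂ) •
    ∑ i, EuclideanSpace.single i 1 ⊗ₜ[ℂ] EuclideanSpace.single i 1 :
      EuclideanSpace ℂ n ⊗[ℂ] EuclideanSpace ℂ n)

set_option maxSynthPendingDepth 3 in
lemma inner_maximallyEntangled_map (A B : Matrix n n ℂ) :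
    inner ℂ (maximallyEntangled n) (HilbertTensor.map (Matrix.toEuclideanCLM (𝕜 := ℂ) A)
      (Matrix.toEuclideanCLM (𝕜 := ℂ) B) (maximallyEntangled n)) =
      (Fintype.card n : ℂ)⁻¹ * (A * Bᵀ).trace := by
  have hcard : ((√(Fintype.card n) : ℝ) : ℂ)⁻¹ * ((√(Fintype.card n) : ℝ) : ℂ)⁻¹ =
      (Fintype.card n : ℂ)⁻¹ := by
    rw [← mul_inv, ← Complex.ofReal_mul, Real.mul_self_sqrt (Nat.cast_nonneg _),
      Complex.ofReal_natCast]
  rw [maximallyEntangled, HilbertTensor.map_coe, UniformSpace.Completion.inner_coe, map_smul,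
    inner_smul_left, inner_smul_right, ← mul_assoc, map_inv₀, Complex.conj_ofReal, hcard, map_sum,
    sum_inner]
  congr 1
  refine Finset.sum_congr rfl fun i _ ↦ ?_
  rw [inner_sum]
  refine Finset.sum_congr rfl fun j _ ↦ ?_
  rw [TensorProduct.mapL_tmul, TensorProduct.inner_tmul, EuclideanSpace.inner_single_left,
    EuclideanSpace.inner_single_left]
  simp [Matrix.ofLp_toEuclideanCLM]

lemma norm_maximallyEntangled [Nonempty n] : ‖maximallyEntangled n‖ = 1 := by
  have hinner : inner ℂ (maximallyEntangled n) (maximallyEntangled n) = 1 := by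
    simpa [HilbertTensor.map_one, Fintype.card_ne_zero] using
      inner_maximallyEntangled_map (1 : Matrix n n ℂ) 1
  rw [norm_eq_sqrt_re_inner (𝕜 := ℂ), hinner, RCLike.one_re, Real.sqrt_one]

end MaximallyEntangled

lemma bitSign_sq (b : Bool) : bitSign b ^ 2 = 1 := by
  cases b <;> simp [bitSign]

lemma one_add_smul_mul_one_add_smul {R A : Type*} [CommRing R] [Ring A] [Algebra R A] {a : A}
    (ha : a * a = 1) (s t : R) :
    (1 + s • a) * (1 + t • a) = (1 + s * t) • (1 : A) + (s + t) • a := by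
  simp only [mul_add, add_mul, mul_one, one_mul, smul_mul_smul_comm, ha]
  module

namespace ProjectiveMeasurement

variable {H : Type*} [NormedAddCommGroup H] [InnerProductSpace ℂ H] [CompleteSpace H]

/-- The `±1`-valued observable `∑ a, (-1) ^ a • M^a` of a binary projective measurement. -/
def observable (M : ProjectiveMeasurement Bool H) : H →L[ℂ] H :=
  ∑ a, (bitSign a : ℂ) • M.proj a

lemma isSelfAdjoint_observable (M : ProjectiveMeasurement Bool H) : IsSelfAdjoint M.observable :=
  isSelfAdjoint_sum _ fun a _ ↦
    .smul (Complex.conj_ofReal (bitSign a)) (M.isStarProjection a).isSelfAdjoint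

lemma observable_mul_self (M : ProjectiveMeasurement Bool H) :
    M.observable * M.observable = 1 := by
  have hidem (a : Bool) : M.proj a * M.proj a = M.proj a := (M.isStarProjection a).isIdempotentElem
  rw [← M.sum_eq_one]
  simp [observable, bitSign, mul_add, add_mul, hidem, M.orthogonal]

lemma observable_mem_unitary (M : ProjectiveMeasurement Bool H) :
    M.observable ∈ unitary (H →L[ℂ] H) := by
  rw [Unitary.mem_iff, M.isSelfAdjoint_observable.star_eq]
  exact ⟨M.observable_mul_self, M.observable_mul_self⟩

/-- The measurement whose outcomes are the eigenspaces of a self-adjoint involution. -/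
def ofInvolution (A : H →L[ℂ] H) (hA : IsSelfAdjoint A) (hAA : A * A = 1) :
    ProjectiveMeasurement Bool H where
  proj a := (2⁻¹ : ℂ) • (1 + (bitSign a : ℂ) • A)
  isStarProjection a := by
    constructor
    · have hsq : (bitSign a : ℂ) * bitSign a = 1 := by cases a <;> simp [bitSign]
      rw [IsIdempotentElem, smul_mul_smul_comm, one_add_smul_mul_one_add_smul hAA, hsq]
      module
    · simp [IsSelfAdjoint, hA.star_eq]
  orthogonal a b hab := by
    have hsum : (bitSign a : ℂ) + bitSign b = 0 := by
      rw [Bool.eq_not_of_ne hab]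
      cases b <;> simp [bitSign]
    have hmul : 1 + (bitSign a : ℂ) * bitSign b = 0 := by
      rw [Bool.eq_not_of_ne hab]
      cases b <;> simp [bitSign]
    rw [smul_mul_smul_comm, one_add_smul_mul_one_add_smul hAA, hsum, hmul, zero_smul, zero_smul,
      add_zero, smul_zero]
  sum_eq_one := by
    simp only [Fintype.sum_bool, bitSign, if_true, Bool.false_eq_true, if_false]
    push_cast
    module

lemma observable_ofInvolution (A : H →L[ℂ] H) (hA : IsSelfAdjoint A) (hAA : A * A = 1) :
    (ofInvolution A hA hAA).observable = A := by
  simp only [observable, ofInvolution, Fintype.sum_bool, bitSign, if_true, Bool.false_eq_true,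
    if_false]
  push_cast
  module

end ProjectiveMeasurement

namespace Box

variable {X Y : Type*}

/-- The correlator `E(x, y) = ∑ a, ∑ b, (-1) ^ (a + b) P(a, b | x, y)`. -/
def correlator (P : Box X Y) (x : X) (y : Y) : ℝ :=
  ∑ a, ∑ b, bitSign a * bitSign b * P a b x y

lemma sum_deterministic (α : X → Bool) (β : Y → Bool) (x : X) (y : Y) :
    ∑ a, ∑ b, deterministic α β a b x y = 1 := by
  simp [deterministic, ite_and]

lemma correlator_deterministic (α : X → Bool) (β : Y → Bool) (x : X) (y : Y) :
    (deterministic α β).correlator x y = bitSign (α x) * bitSign (β y) := by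
  simp [correlator, deterministic, ite_and]

section State

variable {HA HB : Type*} [NormedAddCommGroup HA] [InnerProductSpace ℂ HA] [CompleteSpace HA]
  [NormedAddCommGroup HB] [InnerProductSpace ℂ HB] [CompleteSpace HB]
  (ψ : HilbertTensor HA HB) (M : X → ProjectiveMeasurement Bool HA)
  (N : Y → ProjectiveMeasurement Bool HB)

/-- The box of the measurements `M`, `N` on the state `ψ`. The amplitudes
`⟨ψ| M_x^a ⊗ N_y^b |ψ⟩` are real, so taking real parts loses nothing. -/
def ofState : Box X Y :=
  fun a b x y ↦ (inner ℂ ψ (HilbertTensor.map ((M x).proj a) ((N y).proj b) ψ)).re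

lemma ofReal_ofState (a b : Bool) (x : X) (y : Y) :
    (ofState ψ M N a b x y : ℂ) =
      inner ℂ ψ (HilbertTensor.map ((M x).proj a) ((N y).proj b) ψ) := by
  have hstar : star (HilbertTensor.map ((M x).proj a) ((N y).proj b)) =
      HilbertTensor.map ((M x).proj a) ((N y).proj b) := by
    rw [HilbertTensor.star_map, ((M x).isStarProjection a).isSelfAdjoint.star_eq,
      ((N y).isStarProjection b).isSelfAdjoint.star_eq]
  rw [ofState, ← Complex.conj_eq_iff_re, inner_conj_symm,
    ← ContinuousLinearMap.adjoint_inner_right, ← ContinuousLinearMap.star_eq_adjoint, hstar]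

lemma sum_mul_ofState (s t : Bool → ℝ) (x : X) (y : Y) :
    ∑ a, ∑ b, s a * t b * ofState ψ M N a b x y =
      (inner ℂ ψ (HilbertTensor.map (∑ a, (s a : ℂ) • (M x).proj a)
        (∑ b, (t b : ℂ) • (N y).proj b) ψ)).re := by
  rw [← HilbertTensor.sum_mul_inner_map]
  simp only [← ofReal_ofState, ← Complex.ofReal_mul, ← Complex.ofReal_sum, Complex.ofReal_re]

variable {ψ} in
lemma sum_ofState (hψ : ‖ψ‖ = 1) (x : X) (y : Y) : ∑ a, ∑ b, ofState ψ M N a b x y = 1 := by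
  have hsum := sum_mul_ofState ψ M N 1 1 x y
  simp only [Pi.one_apply, mul_one, one_mul, Complex.ofReal_one, one_smul, (M x).sum_eq_one,
    (N y).sum_eq_one, HilbertTensor.map_one, one_apply_eq_self] at hsum
  rw [hsum, inner_self_eq_norm_sq_to_K, hψ]
  simp

lemma correlator_ofState (x : X) (y : Y) : (ofState ψ M N).correlator x y =
    (inner ℂ ψ (HilbertTensor.map (M x).observable (N y).observable ψ)).re :=
  sum_mul_ofState ψ M N bitSign bitSign x y

end State

lemma isQuantum_iff_exists_eq_ofState {P : Box X Y} :
    P.IsQuantum ↔ ∃ (HA HB : Type) (_ : NormedAddCommGroup HA) (_ : InnerProductSpace ℂ HA)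
      (_ : CompleteSpace HA) (_ : NormedAddCommGroup HB) (_ : InnerProductSpace ℂ HB)
      (_ : CompleteSpace HB) (ψ : HilbertTensor HA HB) (M : X → ProjectiveMeasurement Bool HA)
      (N : Y → ProjectiveMeasurement Bool HB), ‖ψ‖ = 1 ∧ P = ofState ψ M N := by
  simp only [IsQuantum, funext_iff, ← ofReal_ofState, Complex.ofReal_inj]

lemma IsQuantum.sum_eq_one {P : Box X Y} (hP : P.IsQuantum) (x : X) (y : Y) :
    ∑ a, ∑ b, P a b x y = 1 := by
  obtain ⟨_, _, _, _, _, _, _, _, ψ, M, N, hψ, rfl⟩ := isQuantum_iff_exists_eq_ofState.1 hP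
  exact sum_ofState M N hψ x y

lemma IsQuantum.exists_correlator_eq_inner {P : Box X Y} (hP : P.IsQuantum) :
    ∃ (E : Type) (_ : NormedAddCommGroup E) (_ : InnerProductSpace ℝ E) (u : X → E) (v : Y → E),
      (∀ x, ‖u x‖ = 1) ∧ (∀ y, ‖v y‖ = 1) ∧ ∀ x y, P.correlator x y = inner ℝ (u x) (v y) := by
  obtain ⟨HA, HB, _, _, _, _, _, _, ψ, M, N, hψ, rfl⟩ := isQuantum_iff_exists_eq_ofState.1 hP
  refine ⟨HilbertTensor HA HB, inferInstance, InnerProductSpace.rclikeToReal ℂ _,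
    fun x ↦ HilbertTensor.map (M x).observable 1 ψ, fun y ↦ HilbertTensor.map 1 (N y).observable ψ,
    fun x ↦ ?_, fun y ↦ ?_, fun x y ↦ ?_⟩
  · rw [ContinuousLinearMap.norm_map_of_mem_unitary
      (HilbertTensor.map_mem_unitary (M x).observable_mem_unitary (one_mem _)), hψ]
  · rw [ContinuousLinearMap.norm_map_of_mem_unitary
      (HilbertTensor.map_mem_unitary (one_mem _) (N y).observable_mem_unitary), hψ]
  · rw [correlator_ofState, real_inner_eq_re_inner ℂ, HilbertTensor.inner_map_left_map_right,
      (M x).isSelfAdjoint_observable.star_eq]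
    rfl

end Box

section Planar

/-- The qubit observable `re z • Z + im z • X`, a reflection of the plane when `‖z‖ = 1`. -/
def planarObservable (z : ℂ) : Matrix (Fin 2) (Fin 2) ℂ :=
  !![(z.re : ℂ), z.im; z.im, -z.re]

lemma isSelfAdjoint_planarObservable (z : ℂ) : IsSelfAdjoint (planarObservable z) := by
  ext i j
  fin_cases i <;> fin_cases j <;> simp [planarObservable, Matrix.star_apply]

lemma planarObservable_mul_self {z : ℂ} (hz : ‖z‖ = 1) :
    planarObservable z * planarObservable z = 1 := by
  have hre : (z.re : ℂ) * z.re + z.im * z.im = 1 := by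
    have := Complex.normSq_eq_norm_sq z
    rw [Complex.normSq_apply, hz, one_pow] at this
    exact_mod_cast this
  rw [planarObservable, Matrix.mul_fin_two, Matrix.one_fin_two, neg_mul_neg,
    add_comm ((z.im : ℂ) * z.im), hre]
  simp [mul_comm]

lemma trace_planarObservable_mul_transpose (z w : ℂ) :
    (planarObservable z * (planarObservable w)ᵀ).trace = 2 * (inner ℝ z w : ℝ) := by
  simp only [Matrix.trace_fin_two, Matrix.mul_apply, Fin.sum_univ_two, Matrix.transpose_apply,
    planarObservable, Matrix.of_apply, Matrix.cons_val_zero, Matrix.cons_val_one, Complex.inner,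
    Complex.mul_re, Complex.conj_re, Complex.conj_im]
  push_cast
  ring

lemma exists_isQuantum_correlator_eq_inner {X Y : Type*} {u : X → ℂ} {v : Y → ℂ}
    (hu : ∀ x, ‖u x‖ = 1) (hv : ∀ y, ‖v y‖ = 1) :
    ∃ P : Box X Y, P.IsQuantum ∧ ∀ x y, P.correlator x y = inner ℝ (u x) (v y) := by
  let measurement (z : ℂ) (hz : ‖z‖ = 1) :
      ProjectiveMeasurement Bool (EuclideanSpace ℂ (Fin 2)) :=
    .ofInvolution (Matrix.toEuclideanCLM (𝕜 := ℂ) (planarObservable z))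
      ((isSelfAdjoint_planarObservable z).map _)
      (by rw [← map_mul, planarObservable_mul_self hz, map_one])
  refine ⟨Box.ofState (maximallyEntangled (Fin 2)) (fun x ↦ measurement (u x) (hu x))
    (fun y ↦ measurement (v y) (hv y)), Box.isQuantum_iff_exists_eq_ofState.2
      ⟨_, _, _, _, _, _, _, _, _, _, _, norm_maximallyEntangled, rfl⟩, fun x y ↦ ?_⟩
  rw [Box.correlator_ofState, ProjectiveMeasurement.observable_ofInvolution,
    ProjectiveMeasurement.observable_ofInvolution, inner_maximallyEntangled_map,
    trace_planarObservable_mul_transpose, Fintype.card_fin, Nat.cast_ofNat,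
    inv_mul_cancel_left₀ two_ne_zero, Complex.ofReal_re]

end Planar

namespace XORGame

variable {X Y : Type*} [Fintype X] [Fintype Y] (g : XORGame X Y)

include g in
lemma nonempty_right : Nonempty Y := by
  by_contra hY
  rw [not_nonempty_iff] at hY
  simpa using g.p_sum

lemma payoff_eq (a b : Bool) (x : X) (y : Y) :
    g.payoff a b x y = (1 + bitSign (g.f x y) * bitSign a * bitSign b) / 2 := by
  cases hf : g.f x y <;> cases a <;> cases b <;> norm_num [payoff, bitSign, hf]

lemma winProb_eq {P : Box X Y} (hP : ∀ x y, ∑ a, ∑ b, P a b x y = 1) :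
    g.winProb P = 1 / 2 + 1 / 2 * ∑ x, ∑ y, g.gameMatrix x y * P.correlator x y := by
  have hxy (x : X) (y : Y) : ∑ a, ∑ b, g.p x y * g.payoff a b x y * P a b x y =
      1 / 2 * g.p x y + 1 / 2 * (g.gameMatrix x y * P.correlator x y) :=
    calc ∑ a, ∑ b, g.p x y * g.payoff a b x y * P a b x y
        = 1 / 2 * g.p x y * ∑ a, ∑ b, P a b x y +
            1 / 2 * (g.gameMatrix x y * P.correlator x y) := by
          simp only [payoff_eq, Box.correlator, gameMatrix, Matrix.of_apply, Finset.mul_sum,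
            ← Finset.sum_add_distrib]
          refine Finset.sum_congr rfl fun a _ ↦ Finset.sum_congr rfl fun b _ ↦ ?_
          ring
      _ = _ := by rw [hP, mul_one]
  rw [winProb]
  simp only [hxy, Finset.sum_add_distrib, ← Finset.mul_sum, g.p_sum, mul_one]

lemma bddAbove_winProb_isQuantum :
    BddAbove {w | ∃ P : Box X Y, P.IsQuantum ∧ g.winProb P = w} := by
  refine ⟨1 / 2 + 1 / 2 * ∑ x, ∑ y, |g.gameMatrix x y|, ?_⟩
  rintro _ ⟨P, hP, rfl⟩
  obtain ⟨E, _, _, u, v, hu, hv, huv⟩ := hP.exists_correlator_eq_inner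
  rw [g.winProb_eq hP.sum_eq_one]
  gcongr with x _ y _
  have hle : |P.correlator x y| ≤ 1 := by
    simpa [huv, hu, hv] using abs_real_inner_le_norm (u x) (v y)
  calc g.gameMatrix x y * P.correlator x y
      ≤ |g.gameMatrix x y * P.correlator x y| := le_abs_self _
    _ = |g.gameMatrix x y| * |P.correlator x y| := abs_mul _ _
    _ ≤ |g.gameMatrix x y| := mul_le_of_le_one_right (abs_nonneg _) hle

lemma winProb_deterministic (α : X → Bool) (β : Y → Bool) :
    g.winProb (Box.deterministic α β) =
      1 / 2 + 1 / 2 * ∑ x, ∑ y, g.gameMatrix x y * (bitSign (α x) * bitSign (β y)) := by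
  simp only [g.winProb_eq (Box.sum_deterministic α β), Box.correlator_deterministic]

lemma exists_isQuantum_winProb_eq_deterministic (α : X → Bool) (β : Y → Bool) :
    ∃ P : Box X Y, P.IsQuantum ∧ g.winProb P = g.winProb (Box.deterministic α β) := by
  have hnorm (b : Bool) : ‖(bitSign b : ℂ)‖ = 1 := by cases b <;> simp [bitSign]
  obtain ⟨P, hP, hcorr⟩ := exists_isQuantum_correlator_eq_inner
    (fun x ↦ hnorm (α x)) (fun y ↦ hnorm (β y))
  refine ⟨P, hP, ?_⟩
  rw [g.winProb_eq hP.sum_eq_one, g.winProb_deterministic]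
  simp [hcorr, Complex.inner, mul_comm]

variable {g}

lemma noQuantumAdvantage_iff_forall_isQuantum {α : X → Bool} {β : Y → Bool}
    (hopt : g.IsOptimalClassical α β) : g.NoQuantumAdvantage ↔ ∀ P : Box X Y, P.IsQuantum →
      ∑ x, ∑ y, g.gameMatrix x y * P.correlator x y ≤
        ∑ x, ∑ y, g.gameMatrix x y * (bitSign (α x) * bitSign (β y)) := by
  have hattained := g.exists_isQuantum_winProb_eq_deterministic α β
  have hle := le_csSup g.bddAbove_winProb_isQuantum hattained
  calc g.NoQuantumAdvantage ↔ g.quantumValue ≤ g.winProb (Box.deterministic α β) := by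
        rw [NoQuantumAdvantage, ← hopt]
        exact ⟨Eq.le, fun h ↦ h.antisymm hle⟩
    _ ↔ ∀ P : Box X Y, P.IsQuantum → g.winProb P ≤ g.winProb (Box.deterministic α β) := by
        rw [quantumValue, csSup_le_iff g.bddAbove_winProb_isQuantum ⟨_, hattained⟩]
        simp
    _ ↔ _ := forall₂_congr fun P hP ↦ by
        rw [g.winProb_eq hP.sum_eq_one, g.winProb_deterministic]
        constructor <;> intro h <;> linarith

theorem noQuantumAdvantage_iff_posSemidef_certificateMatrix [DecidableEq X] [DecidableEq Y]
    {α : X → Bool} {β : Y → Bool} (hopt : g.IsOptimalClassical α β) :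
    g.NoQuantumAdvantage ↔ (certificateMatrix g.gameMatrix (fun x ↦ bitSign (α x))
      (fun y ↦ bitSign (β y))).PosSemidef := by
  have hsA (x : X) : bitSign (α x) ^ 2 = 1 := bitSign_sq _
  have hsB (y : Y) : bitSign (β y) ^ 2 = 1 := bitSign_sq _
  rw [noQuantumAdvantage_iff_forall_isQuantum hopt]
  constructor
  · refine fun h ↦ posSemidef_certificateMatrix_of_forall_sum_mul_inner_le hsA hsB
      fun u v hu hv ↦ ?_
    obtain ⟨P, hP, hcorr⟩ := exists_isQuantum_correlator_eq_inner hu hv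
    simpa only [hcorr] using h P hP
  · intro h P hP
    obtain ⟨E, _, _, u, v, hu, hv, hcorr⟩ := hP.exists_correlator_eq_inner
    simpa only [hcorr] using sum_mul_inner_le_of_posSemidef_certificateMatrix hsA hsB h hu hv

end XORGame

end

theorem mainTheorem2 {X Y : Type*} [Fintype X] [Fintype Y] [DecidableEq X] [DecidableEq Y]
    (g : XORGame X Y) (Φ : Matrix X Y ℝ) (hΦ : Φ = g.gameMatrix)
    (hrow : ∀ x, ∃ y, Φ x y ≠ 0) (hcol : ∀ y, ∃ x, Φ x y ≠ 0)
    (α : X → Bool) (β : Y → Bool) (hopt : g.IsOptimalClassical α β)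
    (sA : X → ℝ) (hsA : ∀ x, sA x = bitSign (α x))
    (sB : Y → ℝ) (hsB : ∀ y, sB y = bitSign (β y))
    (S : Matrix X X ℝ) (hS : S = sigmaMatrix Φ sA sB)
    (L : Matrix Y Y ℝ) (hL : L = lambdaMatrix Φ sA sB) :
    g.NoQuantumAdvantage ↔
      (S.PosDef ∧ L.PosDef ∧ realSpectralRadius (L⁻¹ * Φᵀ * S⁻¹ * Φ) = 1) := by
  obtain rfl : sA = fun x ↦ bitSign (α x) := funext hsA
  obtain rfl : sB = fun y ↦ bitSign (β y) := funext hsB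
  subst hΦ hS hL
  have := g.nonempty_right
  rw [XORGame.noQuantumAdvantage_iff_posSemidef_certificateMatrix hopt]
  exact posSemidef_certificateMatrix_iff_realSpectralRadius_eq_one hrow hcol
    (fun _ ↦ bitSign_sq _) (fun _ ↦ bitSign_sq _)
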